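/- For a positive integer $\ell$ let $b_\ell(n)$ denote the number of $\ell$-regular partitions of $n$, that is, partitions of $n$ none of whose parts is divisible by $\ell$, with $b_\ell(0)=1$ and $b_\ell(n)=0$ for $n<0$. Let $\alpha$ and $n$ be nonnegative integers, and let $p_1,\dots,p_{\alpha+1}$ be (not necessarily distinct) primes with $p_i\ge 5$ and $p_i\equiv 3 \pmod 4$ for every $i$. Then for every integer $j$ with $j\not\equiv 0 \pmod{p_{\alpha+1}}$, the number $p_1^2\cdots p_\alpha^2\,p_{\alpha+1}(12j+5p_{\alpha+1})-5$ is divisible by $12$ and $$b_{11}\left(p_1^2\cdots p_{\alpha+1}^2\,n+\frac{p_1^2\cdots p_\alpha^2\,p_{\alpha+1}(12j+5p_{\alpha+1})-5}{12}\right)\equiv 0 \pmod{11}.$$ -/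

import Mathlib

/-- `regularPartitionCount ℓ n` is `b_ℓ(n)`: the number of partitions of `n` none of whose parts
is divisible by `ℓ`, and `0` when `n` is negative. -/
def regularPartitionCount (ℓ : ℕ) (n : ℤ) : ℕ :=
  if 0 ≤ n then (Nat.Partition.restricted n.toNat (fun k => ¬ ℓ ∣ k)).card else 0

/-!
Write `E = ∏ (1 - q ^ n)`. Modulo `11` the generating function of the `11`-regular partitions is
`∏ (1 - q ^ (11 * n)) / ∏ (1 - q ^ n) = E ^ 10`. The coefficient of `q ^ m` in `E ^ 10` vanishes
unless `24 * m + 10`, equivalently `12 * m + 5`, is a sum of two squares, because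
`96 * q ^ 10 * E(q ^ 24) ^ 10` is a combination of products of two theta series in the powers
`q ^ (x ^ 2)`. For the indices of the theorem `12 * m + 5 = a ^ 2 * p * u` with a prime
`p ≡ 3 [MOD 4]` not dividing `u`, and such a number is not a sum of two squares.

The formula for `E ^ 10` comes from `2 × 2` determinants. Let `e = q * E(q ^ 24)`, a theta series by
the pentagonal number theorem, so that `2 * e ^ 3 = ∑ χ₄(x) * x * q ^ (3 * x ^ 2) =: J₁` by Jacobi's
identity. The substitution `(x, y) ↦ (x + y, x - y)` in products of two theta series writes both
`e ^ 2` and `J₁ ^ 2` as determinants of theta series, and `(x, y) ↦ (x + 2 * y, x - y)` turns the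
form `x ^ 2 + 2 * y ^ 2` into `3 * x ^ 2 + 6 * y ^ 2` and relates the two matrices by a matrix
product. Taking determinants, `6 * J₁ ^ 4 = 96 * e ^ 12` is `e ^ 2` times a determinant whose
entries are theta series in `q ^ (x ^ 2)` with the weights `x` and `x ^ 3`; now cancel `e ^ 2`.
-/

open Finset

/-- The Gaussian binomial coefficient, evaluated at an element `q` of a commutative ring. -/
def gaussBinom {A : Type*} [CommRing A] (q : A) : ℕ → ℕ → A
  | _, 0 => 1
  | 0, _ + 1 => 0
  | n + 1, k + 1 => gaussBinom q n k + q ^ (k + 1) * gaussBinom q n (k + 1)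

/-- The finite Euler product `(1 - q) (1 - q ^ 2) ⋯ (1 - q ^ n)`. -/
def eulerProd {A : Type*} [CommRing A] (q : A) (n : ℕ) : A :=
  ∏ i ∈ range n, (1 - q ^ (i + 1))

/-- The triangular number `m * (m - 1) / 2` of an integer `m`. With this normalization
`8 * triangular m + 1 = (2 * m - 1) ^ 2`. -/
def triangular (m : ℤ) : ℕ := (m * (m - 1) / 2).toNat

theorem two_mul_triangular (m : ℤ) : 2 * (triangular m : ℤ) = m * (m - 1) := by
  have hdvd : 2 ∣ m * (m - 1) := (Int.even_mul_pred_self m).two_dvd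
  have hnonneg : 0 ≤ m * (m - 1) := by
    rcases le_or_gt m 0 with h | h <;> nlinarith
  rw [triangular]
  omega

theorem triangular_add_one (m : ℤ) : (triangular (m + 1) : ℤ) = triangular m + m := by
  linarith [two_mul_triangular m, two_mul_triangular (m + 1)]

theorem sub_one_le_triangular (m : ℤ) : m - 1 ≤ triangular m := by
  nlinarith [two_mul_triangular m, Int.natCast_nonneg (triangular m)]

theorem neg_le_triangular (m : ℤ) : -m ≤ triangular m := by
  nlinarith [two_mul_triangular m, Int.natCast_nonneg (triangular m)]

theorem finite_fiber_triangular (n : ℕ) : (triangular ⁻¹' {n}).Finite := by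
  refine (Set.finite_Icc (-(n : ℤ)) (n + 1)).subset fun m hm => ?_
  have := sub_one_le_triangular m
  have := neg_le_triangular m
  simp only [Set.mem_preimage, Set.mem_singleton_iff, Set.mem_Icc] at hm ⊢
  omega

section GaussBinom

variable {A : Type*} [CommRing A] (q : A)

theorem eulerProd_succ (n : ℕ) : eulerProd q (n + 1) = eulerProd q n * (1 - q ^ (n + 1)) :=
  prod_range_succ _ _

theorem gaussBinom_zero_right (n : ℕ) : gaussBinom q n 0 = 1 := by
  cases n <;> rfl

theorem gaussBinom_succ_succ (n k : ℕ) :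
    gaussBinom q (n + 1) (k + 1) = gaussBinom q n k + q ^ (k + 1) * gaussBinom q n (k + 1) := rfl

theorem gaussBinom_eq_zero_of_lt {n k : ℕ} (h : n < k) : gaussBinom q n k = 0 := by
  induction n generalizing k with
  | zero =>
    obtain ⟨k, rfl⟩ := Nat.exists_eq_succ_of_ne_zero h.ne'
    rfl
  | succ n ih =>
    obtain ⟨k, rfl⟩ := Nat.exists_eq_succ_of_ne_zero (Nat.ne_zero_of_lt h)
    rw [Nat.succ_eq_add_one, gaussBinom_succ_succ, ih (by omega), ih (by omega), mul_zero, add_zero]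

theorem gaussBinom_self (n : ℕ) : gaussBinom q n n = 1 := by
  induction n with
  | zero => rfl
  | succ n ih =>
    rw [gaussBinom_succ_succ, ih, gaussBinom_eq_zero_of_lt q n.lt_succ_self, mul_zero, add_zero]

theorem gaussBinom_mul_eulerProd (m k : ℕ) :
    gaussBinom q (m + k) k * eulerProd q k * eulerProd q m = eulerProd q (m + k) := by
  induction k generalizing m with
  | zero => simp [gaussBinom_zero_right, eulerProd]
  | succ k ihk =>
    induction m with
    | zero => simp [gaussBinom_self, eulerProd]
    | succ m ihm =>
      have hk := ihk (m + 1)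
      rw [show m + 1 + k = m + (k + 1) by ring] at hk
      rw [show m + 1 + (k + 1) = m + (k + 1) + 1 by ring, gaussBinom_succ_succ, eulerProd_succ q m,
        eulerProd_succ q (m + (k + 1)), eulerProd_succ q k]
      rw [eulerProd_succ q m] at hk
      rw [eulerProd_succ q k] at ihm
      linear_combination (1 - q ^ (k + 1)) * hk + q ^ (k + 1) * (1 - q ^ (m + 1)) * ihm

theorem gaussBinom_succ_succ' (m k : ℕ) :
    gaussBinom q (m + k + 1) (k + 1) =
      gaussBinom q (m + k) (k + 1) + q ^ m * gaussBinom q (m + k) k := by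
  induction m generalizing k with
  | zero => simp [gaussBinom_self, gaussBinom_eq_zero_of_lt]
  | succ m ihm =>
    induction k with
    | zero =>
      have h : gaussBinom q (m + 1) 1 = _ := ihm 0
      have hm := gaussBinom_succ_succ q m 0
      have hm' := gaussBinom_succ_succ q (m + 1) 0
      simp only [gaussBinom_zero_right, zero_add, add_zero] at h hm hm' ⊢
      linear_combination hm' + q * h - hm
    | succ k ihk =>
      have h := ihm (k + 1)
      rw [show m + (k + 1) = m + 1 + k by ring] at h
      rw [← add_assoc]
      linear_combination gaussBinom_succ_succ q (m + 1 + k + 1) (k + 1) + ihk + q ^ (k + 2) * h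
        - gaussBinom_succ_succ q (m + 1 + k) (k + 1)
        - q ^ (m + 1) * gaussBinom_succ_succ q (m + 1 + k) k

end GaussBinom

section TripleProd

open Polynomial

variable {A : Type*} [CommRing A] (q : A)

theorem coeff_prod_X_sub_C_pow (n k : ℕ) :
    (∏ i ∈ range n, (X - C (q ^ i))).coeff k =
      (-1) ^ (n + k) * q ^ triangular (n - k) * gaussBinom q n k := by
  induction n generalizing k with
  | zero => cases k <;> simp [triangular, gaussBinom, coeff_one]
  | succ n ih =>
    rw [prod_range_succ]
    rcases k with _ | k
    · have htri : triangular ((n + 1 : ℕ) - (0 : ℕ)) = triangular (n - (0 : ℕ)) + n := by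
        have := triangular_add_one n
        grind
      simp only [mul_coeff_zero, ih, htri, gaussBinom_zero_right, coeff_sub, coeff_X_zero,
        coeff_C_zero]
      ring
    · have htri : triangular (n - k) + (k + 1) = triangular (n - (k + 1 : ℕ)) + n := by
        have := triangular_add_one (n - (k + 1 : ℕ))
        grind
      have hpow := congrArg (q ^ ·) htri
      simp only [pow_add] at hpow
      rw [coeff_mul_X_sub_C, ih, ih, gaussBinom_succ_succ, Nat.cast_add_one n, Nat.cast_add_one k,
        add_sub_add_right_eq_sub, ← Nat.cast_add_one]
      linear_combination (-1) ^ (n + k + 1) * gaussBinom q n (k + 1) * hpow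

/-- The finite form `∏ i ∈ [1, m], (1 - q ^ i * X) * ∏ i ∈ [0, n), (X - q ^ i)` of the product in
Jacobi's triple product identity. -/
noncomputable def tripleProd (m n : ℕ) : A[X] :=
  (∏ i ∈ range m, (1 - C (q ^ (i + 1)) * X)) * ∏ i ∈ range n, (X - C (q ^ i))

theorem tripleProd_succ_left (m n : ℕ) :
    tripleProd q (m + 1) n = tripleProd q m n - C (q ^ (m + 1)) * (tripleProd q m n * X) := by
  rw [tripleProd, tripleProd, prod_range_succ]
  ring

theorem coeff_tripleProd (m n k : ℕ) :
    (tripleProd q m n).coeff k =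
      (-1) ^ (n + k) * q ^ triangular (n - k) * gaussBinom q (m + n) k := by
  induction m generalizing k with
  | zero => rw [tripleProd, prod_range_zero, one_mul, zero_add, coeff_prod_X_sub_C_pow]
  | succ m ih =>
    rw [tripleProd_succ_left, coeff_sub, coeff_C_mul]
    rcases k with _ | k
    · simp [ih, gaussBinom_zero_right]
    rw [coeff_mul_X, ih, ih]
    rcases lt_or_ge (m + n) k with hk | hk
    · simp [gaussBinom_eq_zero_of_lt q, hk, show m + n < k + 1 by omega,
        show m + 1 + n < k + 1 by omega]
    · obtain ⟨r, hr⟩ := Nat.exists_eq_add_of_le' hk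
      have htri : triangular (n - (k + 1 : ℕ)) + r = m + 1 + triangular (n - k) := by
        have := triangular_add_one (n - (k + 1 : ℕ))
        grind
      have hpow := congrArg (q ^ ·) htri
      simp only [pow_add] at hpow
      rw [show m + 1 + n = r + k + 1 by omega, gaussBinom_succ_succ', hr]
      linear_combination (-1) ^ (n + k) * gaussBinom q (r + k) k * hpow

theorem eval_one_tripleProd_succ (m n : ℕ) : (tripleProd q m (n + 1)).eval 1 = 0 := by
  simp [tripleProd, prod_range_succ', eval_mul]

theorem eval_one_derivative_tripleProd_succ (m n : ℕ) :
    (derivative (tripleProd q m (n + 1))).eval 1 = eulerProd q m * eulerProd q n := by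
  have hfactor : tripleProd q m (n + 1) =
      ((∏ i ∈ range m, (1 - C (q ^ (i + 1)) * X)) * ∏ i ∈ range n, (X - C (q ^ (i + 1)))) *
        (X - 1) := by
    rw [tripleProd, prod_range_succ', pow_zero, C_1, mul_assoc]
  rw [hfactor, derivative_mul]
  simp [eval_mul, eval_prod, eulerProd]

theorem natDegree_tripleProd_lt (m n : ℕ) : (tripleProd q m n).natDegree < m + n + 1 := by
  rw [Nat.lt_succ_iff, natDegree_le_iff_coeff_eq_zero]
  intro k hk
  rw [coeff_tripleProd, gaussBinom_eq_zero_of_lt q hk, mul_zero]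

theorem sum_triangular_mul_gaussBinom (N : ℕ) :
    ∑ k ∈ range (2 * N + 2), (-1) ^ (N + 1 + k) * (2 * k - (2 * N + 1)) *
      q ^ triangular (N + 1 - k) * gaussBinom q (2 * N + 1) k = 2 * eulerProd q N ^ 2 := by
  have hdeg : (tripleProd q N (N + 1)).natDegree < 2 * N + 2 := by
    have := natDegree_tripleProd_lt q N (N + 1)
    omega
  have hcoeff (k : ℕ) : (tripleProd q N (N + 1)).coeff k =
      (-1) ^ (N + 1 + k) * q ^ triangular (N + 1 - k) * gaussBinom q (2 * N + 1) k := by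
    rw [coeff_tripleProd, Nat.cast_add_one, two_mul, add_assoc N N]
  -- `tripleProd q N (N + 1)` has the simple root `1`: its value there contributes nothing, its
  -- derivative the square of the Euler product.
  have h0 := eval_one_tripleProd_succ q N N
  have h1 := eval_one_derivative_tripleProd_succ q N N
  rw [eval_eq_sum_range' hdeg] at h0
  rw [derivative_eval, sum_over_range' _ (by simp) _ hdeg] at h1
  simp only [one_pow, mul_one] at h0 h1
  calc
    _ = 2 * ∑ k ∈ range (2 * N + 2), (tripleProd q N (N + 1)).coeff k * k -
        (2 * N + 1) * ∑ k ∈ range (2 * N + 2), (tripleProd q N (N + 1)).coeff k := by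
      simp only [mul_sum, ← sum_sub_distrib, hcoeff]
      exact sum_congr rfl fun k _ => by ring
    _ = 2 * eulerProd q N ^ 2 := by rw [h0, h1, mul_zero, sub_zero, sq]

end TripleProd

open PowerSeries

section GenSeries

variable {ι κ R : Type*} [CommRing R] {e : ι → ℕ} {e' : κ → ℕ}

/-- The generating series `∑ i, w i * X ^ e i` of a weight `w`, for exponents `e` with finite
fibres. It is linear in `w`. -/
noncomputable def genSeries (he : ∀ n, (e ⁻¹' {n}).Finite) : (ι → R) →ₗ[R] R⟦X⟧ where
  toFun w := PowerSeries.mk fun n => ∑ i ∈ (he n).toFinset, w i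
  map_add' v w := by ext n; simp [sum_add_distrib]
  map_smul' c w := by ext n; simp [mul_sum]

theorem coeff_genSeries (he : ∀ n, (e ⁻¹' {n}).Finite) (w : ι → R) (n : ℕ) :
    coeff n (genSeries he w) = ∑ i ∈ (he n).toFinset, w i := by
  simp [genSeries]

theorem coeff_genSeries_eq_zero (he : ∀ n, (e ⁻¹' {n}).Finite) (w : ι → R) {n : ℕ}
    (h : ∀ i, e i ≠ n) : coeff n (genSeries he w) = 0 := by
  rw [coeff_genSeries]
  exact sum_eq_zero fun i hi => absurd (by simpa using hi) (h i)

theorem genSeries_comp (he : ∀ n, (e ⁻¹' {n}).Finite) (he' : ∀ n, (e' ⁻¹' {n}).Finite)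
    {j : κ → ι} (hj : j.Injective) (hej : ∀ k, e (j k) = e' k) {w : ι → R}
    (hw : ∀ i, w i ≠ 0 → i ∈ Set.range j) :
    genSeries he' (w ∘ j) = genSeries he w := by
  ext n
  rw [coeff_genSeries, coeff_genSeries]
  refine sum_of_injOn j hj.injOn (fun k hk => ?_) (fun i hi hij => ?_) fun _ _ => rfl
  · simpa [hej] using hk
  · by_contra hwi
    obtain ⟨k, rfl⟩ := hw i hwi
    exact hij ⟨k, by simpa [hej] using hi, rfl⟩

theorem finite_preimage_Iic (he : ∀ n, (e ⁻¹' {n}).Finite) (n : ℕ) : {i | e i ≤ n}.Finite :=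
  ((Set.finite_Iic n).biUnion fun m _ => he m).subset fun i hi => by simpa using hi

theorem finite_fiber_add (he : ∀ n, (e ⁻¹' {n}).Finite) (he' : ∀ n, (e' ⁻¹' {n}).Finite) (n : ℕ) :
    ((fun x : ι × κ => e x.1 + e' x.2) ⁻¹' {n}).Finite := by
  refine ((finite_preimage_Iic he n).prod (finite_preimage_Iic he' n)).subset fun x hx => ?_
  simp only [Set.mem_preimage, Set.mem_singleton_iff, Set.mem_prod, Set.mem_ofPred_eq] at hx ⊢
  omega

theorem genSeries_mul (he : ∀ n, (e ⁻¹' {n}).Finite) (he' : ∀ n, (e' ⁻¹' {n}).Finite)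
    (v : ι → R) (w : κ → R) :
    genSeries he v * genSeries he' w =
      genSeries (finite_fiber_add he he') fun x => v x.1 * w x.2 := by
  classical
  ext n
  rw [coeff_mul, coeff_genSeries,
    ← sum_fiberwise_of_maps_to (t := antidiagonal n) (g := fun x : ι × κ => (e x.1, e' x.2))
      (by simp)]
  refine sum_congr rfl fun ⟨a, b⟩ hab => ?_
  replace hab : a + b = n := by simpa using hab
  rw [coeff_genSeries, coeff_genSeries, sum_mul_sum, ← sum_product']
  refine sum_congr ?_ fun _ _ => rfl
  ext ⟨i, k⟩
  simp only [mem_product, Set.Finite.mem_toFinset, Set.mem_preimage, Set.mem_singleton_iff,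
    mem_filter, Prod.mk.injEq]
  omega

theorem X_pow_mul_expand_genSeries {a d : ℕ} (hd : d ≠ 0) (he : ∀ n, (e ⁻¹' {n}).Finite)
    (he' : ∀ n, ((fun i => d * e i + a) ⁻¹' {n}).Finite) (w : ι → R) :
    X ^ a * expand d hd (genSeries he w) = genSeries he' w := by
  ext n
  rw [coeff_X_pow_mul']
  by_cases h : ∃ m, n = d * m + a
  · obtain ⟨m, rfl⟩ := h
    rw [if_pos (by omega), Nat.add_sub_cancel, coeff_expand_mul, coeff_genSeries, coeff_genSeries]
    refine sum_congr ?_ fun _ _ => rfl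
    ext i
    simp [hd]
  · rw [coeff_genSeries_eq_zero _ _ fun i hi => h ⟨_, hi.symm⟩]
    split_ifs with ha
    · refine coeff_expand_of_not_dvd _ _ _ ?_
      rintro ⟨m, hm⟩
      exact h ⟨m, by omega⟩
    · rfl

theorem X_pow_dvd_sum_sub_genSeries (he : ∀ n, (e ⁻¹' {n}).Finite) (w : ι → R) {n : ℕ}
    {s : Finset ι} (hs : ∀ i, e i < n → i ∈ s) :
    X ^ n ∣ ∑ i ∈ s, C (w i) * X ^ e i - genSeries he w := by
  classical
  refine X_pow_dvd_iff.mpr fun m hm => ?_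
  simp only [map_sub, map_sum, coeff_C_mul, coeff_X_pow, mul_ite, mul_one, mul_zero,
    coeff_genSeries, ← sum_filter]
  rw [sub_eq_zero]
  refine sum_congr ?_ fun _ _ => rfl
  ext i
  have := hs i
  simp only [mem_filter, Set.Finite.mem_toFinset, Set.mem_preimage, Set.mem_singleton_iff]
  grind

end GenSeries

section JacobiCube

variable (R : Type*) [CommRing R]

theorem X_pow_dvd_eulerProd_sub {m n : ℕ} (h : n ≤ m) :
    (X : R⟦X⟧) ^ (n + 1) ∣ eulerProd X m - eulerProd X n := by
  induction m, h using Nat.le_induction with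
  | base => simp
  | succ m hm ih =>
    rw [eulerProd_succ, mul_one_sub, sub_right_comm]
    exact dvd_sub ih (Dvd.dvd.mul_left (pow_dvd_pow _ (by omega)) _)

theorem X_pow_dvd_pentagonalSeries_sub (n : ℕ) :
    (X : R⟦X⟧) ^ (n + 1) ∣ pentagonalSeries R - eulerProd X n := by
  rw [X_pow_dvd_iff]
  intro m hm
  obtain ⟨s, hs⟩ := Filter.eventually_atTop.mp (coeff_prod_one_sub_X_pow_eventually_eq R m)
  obtain ⟨K, hK⟩ := s.exists_nat_subset_range
  rw [map_sub, ← hs (range (max K n)) (hK.trans (range_mono (le_max_left _ _))), ← map_sub]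
  exact X_pow_dvd_iff.mp (X_pow_dvd_eulerProd_sub R (le_max_right K n)) m hm

theorem isUnit_pentagonalSeries : IsUnit (pentagonalSeries R) := by
  have h := X_pow_dvd_iff.mp (X_pow_dvd_pentagonalSeries_sub R 0) 0 (by norm_num)
  rw [map_sub, sub_eq_zero] at h
  rw [isUnit_iff_constantCoeff, ← coeff_zero_eq_constantCoeff_apply, h]
  simp [eulerProd]

theorem X_pow_dvd_gaussBinom_mul_sub_one {m k r : ℕ} (hm : r ≤ m) (hk : r ≤ k) :
    (X : R⟦X⟧) ^ (r + 1) ∣ gaussBinom X (m + k) k * pentagonalSeries R - 1 := by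
  set f := pentagonalSeries R
  have hdvd {n : ℕ} (h : r ≤ n) : (X : R⟦X⟧) ^ (r + 1) ∣ f - eulerProd X n :=
    (pow_dvd_pow _ (by omega)).trans (X_pow_dvd_pentagonalSeries_sub R _)
  have hsplit : f * (gaussBinom X (m + k) k * f - 1) =
      gaussBinom X (m + k) k * f * (f - eulerProd X k) +
      gaussBinom X (m + k) k * eulerProd X k * (f - eulerProd X m) -
      (f - eulerProd X (m + k)) := by
    linear_combination gaussBinom_mul_eulerProd (X : R⟦X⟧) m k
  rw [← (isUnit_pentagonalSeries R).dvd_mul_left, hsplit]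
  exact dvd_sub (dvd_add (Dvd.dvd.mul_left (hdvd hk) _) (Dvd.dvd.mul_left (hdvd hm) _))
    (hdvd (by omega))

/-- The coefficient of `q ^ triangular m` in Jacobi's series for twice the cube of the Euler
product. -/
def jacobiWeight (m : ℤ) : ℤ := (m + 1).negOnePow * (2 * m - 1)

theorem sum_jacobiWeight_mul_gaussBinom (N : ℕ) :
    ∑ k ∈ range (2 * N + 2), C (jacobiWeight (N + 1 - k)) * X ^ triangular (N + 1 - k) *
      gaussBinom X (2 * N + 1) k = (2 : ℤ⟦X⟧) * eulerProd X N ^ 2 := by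
  rw [← sum_triangular_mul_gaussBinom]
  refine sum_congr rfl fun k _ => ?_
  have hsign : (((N : ℤ) + 1 - k + 1).negOnePow : ℤ) = -(-1) ^ (N + 1 + k) := by
    rw [Int.negOnePow_succ, Int.negOnePow_sub, ← Int.negOnePow_add, Units.val_neg]
    exact congrArg Neg.neg (Int.coe_negOnePow_natCast (N + 1 + k))
  have hweight : jacobiWeight (N + 1 - k) = (-1) ^ (N + 1 + k) * (2 * k - (2 * N + 1)) := by
    rw [jacobiWeight, hsign]
    ring
  rw [hweight]
  simp

theorem X_pow_dvd_pow_triangular_mul_gaussBinom {N k : ℕ} (hk : k < 2 * N + 2) :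
    (X : ℤ⟦X⟧) ^ (N + 1) ∣ X ^ triangular (N + 1 - k) *
      (gaussBinom X (2 * N + 1) k * pentagonalSeries ℤ - 1) := by
  have h := X_pow_dvd_gaussBinom_mul_sub_one ℤ (min_le_left (2 * N + 1 - k) k)
    (min_le_right (2 * N + 1 - k) k)
  rw [Nat.sub_add_cancel (by omega)] at h
  refine (pow_dvd_pow _ ?_).trans ((pow_add (X : ℤ⟦X⟧) _ _).dvd.trans (mul_dvd_mul_left _ h))
  have := sub_one_le_triangular (N + 1 - k)
  have := neg_le_triangular (N + 1 - k)
  omega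

theorem X_pow_dvd_two_mul_cube_sub_sum (N : ℕ) :
    (X : ℤ⟦X⟧) ^ (N + 1) ∣ 2 * pentagonalSeries ℤ ^ 3 -
      ∑ k ∈ range (2 * N + 2), C (jacobiWeight (N + 1 - k)) * X ^ triangular (N + 1 - k) := by
  set f := pentagonalSeries ℤ
  have hsplit : 2 * f ^ 3 -
      ∑ k ∈ range (2 * N + 2), C (jacobiWeight (N + 1 - k)) * X ^ triangular (N + 1 - k) =
      2 * f * (f + eulerProd X N) * (f - eulerProd X N) +
      ∑ k ∈ range (2 * N + 2), C (jacobiWeight (N + 1 - k)) *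
        (X ^ triangular (N + 1 - k) * (gaussBinom X (2 * N + 1) k * f - 1)) := by
    simp only [mul_sub, sum_sub_distrib]
    simp only [← mul_assoc, ← sum_mul, sum_jacobiWeight_mul_gaussBinom]
    ring
  rw [hsplit]
  refine dvd_add (Dvd.dvd.mul_left (X_pow_dvd_pentagonalSeries_sub ℤ N) _)
    (dvd_sum fun k hk => Dvd.dvd.mul_left ?_ _)
  exact X_pow_dvd_pow_triangular_mul_gaussBinom (mem_range.mp hk)

variable {R} in
theorem eq_of_forall_X_pow_dvd_sub {f g : R⟦X⟧}
    (h : ∀ n, X ^ (n + 1) ∣ f - g) : f = g := by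
  ext n
  simpa [sub_eq_zero] using X_pow_dvd_iff.mp (h n) n n.lt_succ_self

theorem two_mul_pentagonalSeries_cube :
    2 * pentagonalSeries ℤ ^ 3 = genSeries finite_fiber_triangular jacobiWeight := by
  refine eq_of_forall_X_pow_dvd_sub fun N => ?_
  have hinj : Function.Injective fun k : ℕ => (N : ℤ) + 1 - k := fun k l h => by grind
  have hcover (m : ℤ) (hm : triangular m < N + 1) :
      m ∈ (range (2 * N + 2)).map ⟨fun k : ℕ => (N : ℤ) + 1 - k, hinj⟩ := by
    have := sub_one_le_triangular m
    have := neg_le_triangular m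
    simp only [mem_map, mem_range, Function.Embedding.coeFn_mk]
    exact ⟨(N + 1 - m).toNat, by omega, by omega⟩
  have h := X_pow_dvd_sum_sub_genSeries finite_fiber_triangular jacobiWeight hcover
  rw [sum_map] at h
  simpa using dvd_add (X_pow_dvd_two_mul_cube_sub_sum N) h

end JacobiCube

section Theta

variable {R : Type*} [CommRing R] (c d : ℕ) [NeZero c] [NeZero d]

theorem finite_fiber_mul_sq (n : ℕ) : ((fun x : ℤ => c * x.natAbs ^ 2) ⁻¹' {n}).Finite := by
  refine (Set.finite_Icc (-(n : ℤ)) n).subset fun x hx => ?_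
  have hx : c * x.natAbs ^ 2 = n := hx
  have := Nat.le_self_pow two_ne_zero x.natAbs
  have := Nat.le_mul_of_pos_left (x.natAbs ^ 2) (NeZero.pos c)
  rw [Set.mem_Icc]
  omega

/-- The theta series `∑ x : ℤ, w x * X ^ (c * x ^ 2)`. -/
noncomputable def theta : (ℤ → R) →ₗ[R] R⟦X⟧ :=
  genSeries (finite_fiber_mul_sq c)

/-- The binary theta series `∑ (x, y) : ℤ × ℤ, w (x, y) * X ^ (c * x ^ 2 + d * y ^ 2)`. -/
noncomputable def theta₂ : (ℤ × ℤ → R) →ₗ[R] R⟦X⟧ :=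
  genSeries (finite_fiber_add (finite_fiber_mul_sq c) (finite_fiber_mul_sq d))

theorem theta_mul (v w : ℤ → R) :
    theta c v * theta d w = theta₂ c d fun z => v z.1 * w z.2 :=
  genSeries_mul _ _ v w

theorem theta_comp_neg (w : ℤ → R) : theta c (w ∘ Neg.neg) = theta c w :=
  genSeries_comp _ _ neg_injective (by simp) fun x _ => ⟨-x, neg_neg x⟩

theorem theta_eq_zero_of_odd [IsAddTorsionFree R] {w : ℤ → R} (hw : w.Odd) : theta c w = 0 := by
  have h := theta_comp_neg c w
  rw [show w ∘ Neg.neg = -w from funext hw, map_neg] at h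
  ext n
  simpa [neg_eq_self] using congrArg (coeff n) h

variable {c d}

theorem theta₂_comp {c' d' : ℕ} [NeZero c'] [NeZero d'] {j : ℤ × ℤ → ℤ × ℤ} (hj : j.Injective)
    (hform : ∀ z, (c * (j z).1 ^ 2 + d * (j z).2 ^ 2 : ℤ) = c' * z.1 ^ 2 + d' * z.2 ^ 2)
    {w : ℤ × ℤ → R} (hw : ∀ z, w z ≠ 0 → z ∈ Set.range j) :
    theta₂ c' d' (w ∘ j) = theta₂ c d w := by
  refine genSeries_comp _ _ hj (fun z => ?_) hw
  zify
  simpa only [sq_abs] using hform z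

theorem theta₂_rotate {c' : ℕ} [NeZero c'] (hc : c' = 2 * c) {w : ℤ × ℤ → R}
    (hw : ∀ z, w z ≠ 0 → 2 ∣ z.1 - z.2) :
    theta₂ c' c' (fun z => w (z.1 + z.2, z.1 - z.2)) = theta₂ c c w := by
  refine theta₂_comp (j := fun z => (z.1 + z.2, z.1 - z.2)) ?_ ?_ fun z hz => ?_
  · rintro ⟨x, y⟩ ⟨x', y'⟩ h
    simp only [Prod.mk.injEq] at h ⊢
    omega
  · intro z
    rw [hc]
    push_cast
    ring
  · have := hw z hz
    exact ⟨((z.1 + z.2) / 2, (z.1 - z.2) / 2), Prod.ext (by grind) (by grind)⟩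

theorem theta₂_one_two {w : ℤ × ℤ → R} (hw : ∀ z, w z ≠ 0 → 3 ∣ z.2 - z.1) :
    theta₂ 3 6 (fun z => w (z.1 + 2 * z.2, z.1 - z.2)) = theta₂ 1 2 w := by
  refine theta₂_comp (j := fun z => (z.1 + 2 * z.2, z.1 - z.2)) ?_ ?_ fun z hz => ?_
  · rintro ⟨x, y⟩ ⟨x', y'⟩ h
    simp only [Prod.mk.injEq] at h ⊢
    omega
  · intro z
    push_cast
    ring
  · have := hw z hz
    exact ⟨((z.1 + 2 * z.2) / 3, (z.1 - z.2) / 3), Prod.ext (by grind) (by grind)⟩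

end Theta

/-- The indicator function of the residue class of `r` modulo `m`, on residues modulo `12`; this
is meaningful for the divisors `m` of `12`. -/
def residueIndicator (m : ℕ) (r : ZMod m) (a : ZMod 12) : ℤ :=
  if (a.cast : ZMod m) = r then 1 else 0

/-- The nontrivial character modulo `4`, on residues modulo `12`. -/
def signFour (a : ZMod 12) : ℤ := ZMod.χ₄ a.cast

/-- The sign in the pentagonal number theorem: `(-1) ^ n` at `6 * n - 1`. -/
def pentagonalSign (a : ZMod 12) : ℤ := residueIndicator 12 11 a - residueIndicator 12 5 a

/-- The theta series `∑ x : ℤ, s x * x ^ k * X ^ (c * x ^ 2)`, the sign `s` depending on `x`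
modulo `12`. -/
noncomputable def momentTheta (c : ℕ) [NeZero c] (s : ZMod 12 → ℤ) (k : ℕ) : ℤ⟦X⟧ :=
  theta c fun x => s x * x ^ k

section MomentTheta

variable {c d : ℕ} [NeZero c] [NeZero d]

theorem momentTheta_mul (s t : ZMod 12 → ℤ) (k l : ℕ) :
    momentTheta c s k * momentTheta d t l =
      theta₂ c d fun z => s z.1 * t z.2 * (z.1 ^ k * z.2 ^ l) := by
  rw [momentTheta, momentTheta, theta_mul]
  congr! 2
  ring

theorem momentTheta_eq_zero {s : ZMod 12 → ℤ} (hs : s.Even) {k : ℕ} (hk : Odd k) :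
    momentTheta c s k = 0 :=
  theta_eq_zero_of_odd c fun x => by rw [Int.cast_neg, hs, hk.neg_pow, mul_neg]

theorem theta₂_add_mul_pow (s t : ZMod 12 → ℤ) (a : ℤ) (k : ℕ) :
    theta₂ c d (fun z => s z.1 * t z.2 * (z.1 + a * z.2) ^ k) =
      ∑ i ∈ range (k + 1), (a ^ (k - i) * k.choose i : ℤ) *
        (momentTheta c s i * momentTheta d t (k - i)) := by
  have hw : (fun z : ℤ × ℤ => s z.1 * t z.2 * (z.1 + a * z.2) ^ k) =
      ∑ i ∈ range (k + 1), (a ^ (k - i) * k.choose i) •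
        fun z : ℤ × ℤ => s z.1 * t z.2 * (z.1 ^ i * z.2 ^ (k - i)) := by
    funext z
    simp only [add_pow, mul_sum, Finset.sum_apply, Pi.smul_apply, smul_eq_mul, mul_pow]
    exact sum_congr rfl fun i _ => by ring
  rw [hw, map_sum]
  exact sum_congr rfl fun i _ => by rw [map_zsmul, zsmul_eq_mul, momentTheta_mul]

theorem coeff_momentTheta_one_mul_eq_zero (s t : ZMod 12 → ℤ) (k l : ℕ) {n : ℕ}
    (hn : ∀ x y : ℤ, (n : ℤ) ≠ x ^ 2 + y ^ 2) :
    coeff n (momentTheta 1 s k * momentTheta 1 t l) = 0 := by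
  rw [momentTheta_mul]
  refine coeff_genSeries_eq_zero _ _ fun z hz => hn z.1 z.2 ?_
  simp [← hz]

end MomentTheta

section EtaIdentity

local notation "J" => momentTheta 3 signFour
local notation "V(" r ")" => momentTheta 6 (residueIndicator 2 r)
local notation "D(" r ")" => momentTheta 2 (residueIndicator 6 r) 0
local notation "G(" r ")" => momentTheta 1 (fun a => signFour a * residueIndicator 6 r a)

theorem intCast_residueIndicator {m : ℕ} (hm : m ∣ 12) (r : ZMod m) (x : ℤ) :
    residueIndicator m r x = if (x : ZMod m) = r then 1 else 0 := by
  rw [residueIndicator, ZMod.cast_intCast hm]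

theorem dvd_of_cast_sub_eq_zero {m : ℕ} (hm : m ∣ 12) {x y : ℤ}
    (h : ((x : ZMod 12) - y).cast = (0 : ZMod m)) : (m : ℤ) ∣ x - y := by
  rwa [← Int.cast_sub, ZMod.cast_intCast hm, ZMod.intCast_zmod_eq_zero_iff_dvd] at h

theorem sq_momentTheta_signFour_one : J 1 ^ 2 = 2 * (V(1) 2 * V(0) 0 - V(1) 0 * V(0) 2) := by
  have hsupp : ∀ a b : ZMod 12, signFour a * signFour b ≠ 0 → (a - b).cast = (0 : ZMod 2) := by
    decide
  have hsign : ∀ a b : ZMod 12, signFour (a + b) * signFour (a - b) =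
      residueIndicator 2 1 a * residueIndicator 2 0 b
        - residueIndicator 2 0 a * residueIndicator 2 1 b := by decide
  have hrotate := theta₂_rotate (c := 3) (c' := 6) rfl
    (w := fun z => signFour z.1 * signFour z.2 * (z.1 ^ 1 * z.2 ^ 1)) fun z hz =>
      dvd_of_cast_sub_eq_zero (by norm_num) (hsupp _ _ (left_ne_zero_of_mul hz))
  calc
    J 1 ^ 2 = V(1) 2 * V(0) 0 - V(0) 2 * V(1) 0 - V(1) 0 * V(0) 2 + V(0) 0 * V(1) 2 := by
      rw [sq, momentTheta_mul, ← hrotate]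
      simp only [momentTheta_mul, ← map_sub, ← map_add]
      congr 1
      funext z
      push_cast
      simp only [hsign, Pi.add_apply, Pi.sub_apply]
      ring
    _ = _ := by ring

theorem sq_momentTheta_pentagonalSign :
    momentTheta 1 pentagonalSign 0 ^ 2 = D(5) * D(0) - D(2) * D(3) := by
  have hsupp : ∀ a b : ZMod 12, pentagonalSign a * pentagonalSign b ≠ 0 →
      (a - b).cast = (0 : ZMod 2) := by decide
  have hsign : ∀ a b : ZMod 12, pentagonalSign (a + b) * pentagonalSign (a - b) =
      residueIndicator 6 5 a * residueIndicator 6 0 b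
        - residueIndicator 6 2 a * residueIndicator 6 3 b := by decide
  have hrotate := theta₂_rotate (c := 1) (c' := 2) rfl
    (w := fun z => pentagonalSign z.1 * pentagonalSign z.2 * (z.1 ^ 0 * z.2 ^ 0)) fun z hz =>
      dvd_of_cast_sub_eq_zero (by norm_num) (hsupp _ _ (left_ne_zero_of_mul hz))
  rw [sq, momentTheta_mul, ← hrotate]
  simp only [momentTheta_mul, ← map_sub]
  congr 1
  funext z
  push_cast
  simp only [hsign, Pi.sub_apply]
  ring

theorem momentTheta_residueIndicator_neg (r : ZMod 6) : D(-r) = D(r) := by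
  have hneg : ∀ (r : ZMod 6) (a : ZMod 12),
      residueIndicator 6 (-r) a = residueIndicator 6 r (-a) := by decide
  simp only [momentTheta, hneg]
  rw [← theta_comp_neg 2 fun x : ℤ => residueIndicator 6 r x * x ^ 0]
  congr 1
  funext x
  simp

theorem sum_momentTheta_mul_shift (ε : ZMod 2) (k : ℕ) :
    G(1) k * D(1 + 3 * ε.val) + G(3) k * D(3 + 3 * ε.val) + G(5) k * D(5 + 3 * ε.val) =
      (-1) ^ ε.val * ∑ i ∈ range (k + 1), (2 ^ (k - i) * k.choose i : ℤ) *
        (J i * V(ε) (k - i)) := by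
  set r : ZMod 6 := 3 * ε.val
  have hsupp : ∀ a b : ZMod 12, ∀ ε : ZMod 2, residueIndicator 6 (3 * ε.val) (b - a) ≠ 0 →
      (b - a).cast = (0 : ZMod 3) := by decide
  have hsplit : ∀ a b : ZMod 12, ∀ r : ZMod 6, signFour a * residueIndicator 6 r (b - a) =
      signFour a * (residueIndicator 6 1 a * residueIndicator 6 (1 + r) b +
        residueIndicator 6 3 a * residueIndicator 6 (3 + r) b +
        residueIndicator 6 5 a * residueIndicator 6 (5 + r) b) := by decide
  have hsign : ∀ a b : ZMod 12, ∀ ε : ZMod 2,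
      signFour (a + 2 * b) * residueIndicator 6 (3 * ε.val) (a - b - (a + 2 * b)) =
        (-1) ^ ε.val * (signFour a * residueIndicator 2 ε b) := by decide
  have hshear := theta₂_one_two
    (w := fun z => signFour z.1 * residueIndicator 6 r (z.2 - z.1) * z.1 ^ k) fun z hz =>
      dvd_of_cast_sub_eq_zero (m := 3) (by norm_num)
        (hsupp _ _ ε (right_ne_zero_of_mul (left_ne_zero_of_mul hz)))
  calc
    _ = theta₂ 1 2 fun z => signFour z.1 * residueIndicator 6 r (z.2 - z.1) * z.1 ^ k := by
      simp only [momentTheta_mul, ← map_add, hsplit]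
      congr 1
      funext z
      simp only [Pi.add_apply]
      ring
    _ = (-1) ^ ε.val * theta₂ 3 6 fun z => signFour z.1 * residueIndicator 2 ε z.2 *
        (z.1 + 2 * z.2) ^ k := by
      have hunit : ((-1) ^ ε.val : ℤ⟦X⟧) = ((-1) ^ ε.val : ℤ) := by norm_cast
      rw [← hshear, hunit, ← zsmul_eq_mul, ← map_zsmul]
      congr 1
      funext z
      push_cast
      rw [hsign]
      simp only [Pi.smul_apply, smul_eq_mul]
      ring
    _ = _ := by rw [theta₂_add_mul_pow]

theorem residueIndicator_two_even : ∀ ε, (residueIndicator 2 ε).Even := by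
  unfold Function.Even
  decide

theorem sum_momentTheta_one_mul_shift (ε : ZMod 2) :
    G(1) 1 * D(1 + 3 * ε.val) + G(3) 1 * D(3 + 3 * ε.val) + G(5) 1 * D(5 + 3 * ε.val) =
      (-1) ^ ε.val * (J 1 * V(ε) 0) := by
  have hV1 : V(ε) 1 = 0 := momentTheta_eq_zero (residueIndicator_two_even ε) (by decide)
  rw [sum_momentTheta_mul_shift]
  simp [sum_range_succ, hV1]

theorem sum_momentTheta_three_mul_shift (ε : ZMod 2) :
    G(1) 3 * D(1 + 3 * ε.val) + G(3) 3 * D(3 + 3 * ε.val) + G(5) 3 * D(5 + 3 * ε.val) =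
      (-1) ^ ε.val * (J 3 * V(ε) 0 + 12 * (J 1 * V(ε) 2)) := by
  have hV1 : V(ε) 1 = 0 := momentTheta_eq_zero (residueIndicator_two_even ε) (by decide)
  have hV3 : V(ε) 3 = 0 := momentTheta_eq_zero (residueIndicator_two_even ε) (by decide)
  rw [sum_momentTheta_mul_shift]
  norm_num [sum_range_succ, hV1, hV3, add_comm]

theorem six_mul_momentTheta_signFour_one_pow_four :
    6 * J 1 ^ 4 = momentTheta 1 pentagonalSign 0 ^ 2 *
      (G(3) 1 * (G(1) 3 + G(5) 3) - (G(1) 1 + G(5) 1) * G(3) 3) := by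
  have hD1 : D(1) = D(5) := momentTheta_residueIndicator_neg 5
  have hD4 : D(4) = D(2) := momentTheta_residueIndicator_neg 2
  have even_one : G(1) 1 * D(1) + G(3) 1 * D(3) + G(5) 1 * D(5) = J 1 * V(0) 0 :=
    (sum_momentTheta_one_mul_shift 0).trans (by simp)
  have even_three : G(1) 3 * D(1) + G(3) 3 * D(3) + G(5) 3 * D(5) =
      J 3 * V(0) 0 + 12 * (J 1 * V(0) 2) :=
    (sum_momentTheta_three_mul_shift 0).trans (by simp)
  have odd_one : G(1) 1 * D(4) + G(3) 1 * D(0) + G(5) 1 * D(2) = -(J 1 * V(1) 0) :=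
    (sum_momentTheta_one_mul_shift 1).trans (by simp [ZMod.val_one])
  have odd_three : G(1) 3 * D(4) + G(3) 3 * D(0) + G(5) 3 * D(2) =
      -(J 3 * V(1) 0 + 12 * (J 1 * V(1) 2)) :=
    (sum_momentTheta_three_mul_shift 1).trans (by simp [ZMod.val_one])
  calc
    6 * J 1 ^ 4 = (J 3 * V(0) 0 + 12 * (J 1 * V(0) 2)) * -(J 1 * V(1) 0) -
        J 1 * V(0) 0 * -(J 3 * V(1) 0 + 12 * (J 1 * V(1) 2)) := by
      linear_combination 6 * J 1 ^ 2 * sq_momentTheta_signFour_one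
    _ = _ := by
      rw [← even_one, ← even_three, ← odd_one, ← odd_three, hD1, hD4,
        sq_momentTheta_pentagonalSign]
      ring

end EtaIdentity

section EulerPowers

theorem X_pow_mul_expand_genSeries_comp {ι R : Type*} [CommRing R] {e : ι → ℕ}
    (he : ∀ n, (e ⁻¹' {n}).Finite) {c : ℕ} [NeZero c] {a d : ℕ} (hd : d ≠ 0) {j : ι → ℤ}
    (hj : j.Injective) (hform : ∀ i, c * j i ^ 2 = d * e i + a) {w : ℤ → R}
    (hw : ∀ x, w x ≠ 0 → x ∈ Set.range j) :
    X ^ a * expand d hd (genSeries he (w ∘ j)) = theta c w := by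
  have hexp (i : ι) : c * (j i).natAbs ^ 2 = d * e i + a := by
    zify
    simpa only [sq_abs] using hform i
  have hfin (n : ℕ) : ((fun i => d * e i + a) ⁻¹' {n}).Finite := by
    simp only [← hexp]
    exact (finite_fiber_mul_sq c n).preimage (f := j) hj.injOn
  rw [X_pow_mul_expand_genSeries hd he hfin]
  exact genSeries_comp _ hfin hj hexp hw

theorem finite_fiber_pentagonal (n : ℕ) : (pentagonal ⁻¹' {n}).Finite :=
  (Set.finite_singleton n).preimage pentagonal_injective.injOn

theorem pentagonalSeries_eq_genSeries :
    pentagonalSeries ℤ = genSeries finite_fiber_pentagonal fun k => (k.negOnePow : ℤ) := by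
  ext n
  by_cases h : n ∈ Set.range pentagonal
  · obtain ⟨k, rfl⟩ := h
    have hfiber : (finite_fiber_pentagonal (pentagonal k)).toFinset = {k} := by
      ext i
      simp
    rw [coeff_pentagonalSeries_pentagonal, coeff_genSeries, hfiber, sum_singleton, Int.cast_id]
  · rw [coeff_pentagonalSeries_eq_zero _ h, coeff_genSeries_eq_zero _ _ fun k hk => h ⟨k, hk⟩]

theorem pentagonalSign_intCast (x : ℤ) :
    pentagonalSign x = (if x % 12 = 11 then 1 else 0) - if x % 12 = 5 then 1 else 0 := by
  simp only [pentagonalSign, intCast_residueIndicator dvd_rfl]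
  congr 1
  · exact if_congr (ZMod.intCast_eq_intCast_iff' x 11 12) rfl rfl
  · exact if_congr (ZMod.intCast_eq_intCast_iff' x 5 12) rfl rfl

theorem signFour_intCast (x : ℤ) :
    signFour x = if x % 2 = 0 then 0 else if x % 4 = 1 then 1 else -1 := by
  rw [signFour, ZMod.cast_intCast (by norm_num), ZMod.χ₄_int_eq_if_mod_four]

theorem X_mul_expand_pentagonalSeries :
    X * expand 24 (by norm_num) (pentagonalSeries ℤ) = momentTheta 1 pentagonalSign 0 := by
  have hj : Function.Injective fun k : ℤ => 6 * k - 1 := fun x y h => by grind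
  have hsign : (fun k : ℤ => (k.negOnePow : ℤ)) =
      (fun x : ℤ => pentagonalSign x * x ^ 0) ∘ fun k : ℤ => 6 * k - 1 := by
    funext k
    simp only [Function.comp_apply, pow_zero, mul_one, pentagonalSign_intCast]
    rcases Int.even_or_odd k with h | h
    · rw [Int.negOnePow_even _ h, Units.val_one]
      grind
    · rw [Int.negOnePow_odd _ h, Units.val_neg, Units.val_one]
      grind
  have h := X_pow_mul_expand_genSeries_comp finite_fiber_pentagonal (c := 1) (a := 1) (d := 24)
    (by norm_num) hj (fun k => ?_) (w := fun x : ℤ => pentagonalSign x * x ^ 0) fun x hx =>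
      ⟨(x + 1) / 6, ?_⟩
  · rwa [pow_one, ← hsign, ← pentagonalSeries_eq_genSeries] at h
  · push_cast
    linear_combination -12 * two_mul_natCast_pentagonal k
  · have := left_ne_zero_of_mul hx
    rw [pentagonalSign_intCast] at this
    grind

theorem momentTheta_signFour_one :
    momentTheta 3 signFour 1 = 2 * momentTheta 1 pentagonalSign 0 ^ 3 := by
  have hj : Function.Injective fun m : ℤ => 2 * m - 1 := fun x y h => by grind
  have hsign : jacobiWeight = (fun x : ℤ => signFour x * x ^ 1) ∘ fun m : ℤ => 2 * m - 1 := by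
    funext m
    simp only [Function.comp_apply, pow_one, signFour_intCast, jacobiWeight]
    rcases Int.even_or_odd m with h | h
    · rw [Int.negOnePow_odd _ h.add_one, Units.val_neg, Units.val_one]
      grind
    · rw [Int.negOnePow_even _ h.add_one, Units.val_one]
      grind
  have h := X_pow_mul_expand_genSeries_comp finite_fiber_triangular (c := 3) (a := 3) (d := 24)
    (by norm_num) hj (fun m => ?_) (w := fun x : ℤ => signFour x * x ^ 1) fun x hx =>
      ⟨(x + 1) / 2, ?_⟩
  · rw [momentTheta, ← h, ← hsign, ← two_mul_pentagonalSeries_cube, map_mul, map_pow, map_ofNat,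
      ← X_mul_expand_pentagonalSeries]
    ring
  · push_cast
    linear_combination -12 * two_mul_triangular m
  · have := left_ne_zero_of_mul hx
    rw [signFour_intCast] at this
    grind

theorem momentTheta_pentagonalSign_ne_zero : momentTheta 1 pentagonalSign 0 ≠ 0 := by
  rw [← X_mul_expand_pentagonalSeries, mul_ne_zero_iff]
  refine ⟨X_ne_zero, fun h => ?_⟩
  have hone : coeff 0 (pentagonalSeries ℤ) = 1 := coeff_pentagonalSeries_pentagonal ℤ 0
  rw [coeff_zero_eq_constantCoeff_apply, ← constantCoeff_expand 24 (by norm_num), h,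
    map_zero] at hone
  exact zero_ne_one hone

theorem coeff_pentagonalSeries_pow_ten_eq_zero {m : ℕ}
    (hm : ∀ x y : ℤ, (24 * m + 10 : ℤ) ≠ x ^ 2 + y ^ 2) :
    coeff m (pentagonalSeries ℤ ^ 10) = 0 := by
  set f := momentTheta 1 pentagonalSign 0
  let g (r : ZMod 6) := momentTheta 1 fun a => signFour a * residueIndicator 6 r a
  have hdet : C 96 * f ^ 10 = g 3 1 * (g 1 3 + g 5 3) - (g 1 1 + g 5 1) * g 3 3 := by
    refine mul_left_cancel₀ (pow_ne_zero 2 momentTheta_pentagonalSign_ne_zero) ?_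
    rw [← six_mul_momentTheta_signFour_one_pow_four, momentTheta_signFour_one,
      map_ofNat C 96]
    ring
  have hvanish (r s : ZMod 6) (k l : ℕ) : coeff (24 * m + 10) (g r k * g s l) = 0 :=
    coeff_momentTheta_one_mul_eq_zero _ _ _ _ (by exact_mod_cast hm)
  have hcoeff := congrArg (coeff (24 * m + 10)) hdet
  rw [mul_add, add_mul, map_sub, map_add, map_add, hvanish, hvanish, hvanish, hvanish,
    coeff_C_mul, show f = _ from X_mul_expand_pentagonalSeries.symm, mul_pow, ← map_pow,
    coeff_X_pow_mul, coeff_expand_mul] at hcoeff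
  omega

end EulerPowers

section RegularPartitions

theorem map_pentagonalSeries {R S : Type*} [CommRing R] [CommRing S] (f : R →+* S) :
    PowerSeries.map f (pentagonalSeries R) = pentagonalSeries S := by
  ext n
  rw [coeff_map]
  by_cases h : n ∈ Set.range pentagonal
  · obtain ⟨k, rfl⟩ := h
    simp [coeff_pentagonalSeries_pentagonal]
  · simp [coeff_pentagonalSeries_eq_zero _ h]

theorem geom_sum_eq_one_sub_pow {R : Type*} [CommRing R] [IsDomain R] (p : ℕ) [Fact p.Prime]
    [CharP R p] {x : R} (hx : x ≠ 1) :
    ∑ j ∈ range p, x ^ j = (1 - x) ^ (p - 1) := by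
  refine mul_right_cancel₀ (sub_ne_zero.mpr hx.symm) ?_
  rw [geom_sum_mul_neg, ← pow_succ, Nat.sub_add_cancel (Fact.out : p.Prime).one_le,
    sub_pow_char, one_pow]

open scoped PowerSeries.WithPiTopology in
theorem mk_card_restricted_eq_pentagonalSeries_pow (p : ℕ) [hp : Fact p.Prime] :
    PowerSeries.mk (fun n => ((Nat.Partition.restricted n (¬ p ∣ ·)).card : ZMod p)) =
      pentagonalSeries (ZMod p) ^ (p - 1) := by
  let _ : TopologicalSpace (ZMod p) := ⊥
  have _ : DiscreteTopology (ZMod p) := ⟨rfl⟩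
  have : CharP (ZMod p)⟦X⟧ p := charP_of_injective_algebraMap (R := ZMod p)
    (FaithfulSMul.algebraMap_injective _ _) p
  rw [Nat.Partition.powerSeriesMk_card_restricted_eq_powerSeriesMk_card_countRestricted _
      hp.out.pos, Nat.Partition.powerSeriesMk_card_countRestricted_eq_tprod _ hp.out.pos,
    ← ((WithPiTopology.hasProd_one_sub_X_pow (ZMod p)).pow (p - 1)).tprod_eq]
  refine tprod_congr fun i => ?_
  simp only [pow_mul]
  refine geom_sum_eq_one_sub_pow p fun h => ?_
  simpa using congrArg constantCoeff h

theorem natCast_regularPartitionCount (p m : ℕ) [Fact p.Prime] :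
    (regularPartitionCount p m : ZMod p) = (coeff m (pentagonalSeries ℤ ^ (p - 1)) : ℤ) := by
  rw [← eq_intCast (Int.castRingHom (ZMod p)), ← coeff_map, map_pow, map_pentagonalSeries,
    ← mk_card_restricted_eq_pentagonalSeries_pow, coeff_mk]
  rfl

theorem regularPartitionCount_eleven_modEq_zero {m : ℤ}
    (hm : ∀ x y : ℤ, 12 * m + 5 ≠ x ^ 2 + y ^ 2) :
    regularPartitionCount 11 m ≡ 0 [MOD 11] := by
  rcases lt_or_ge m 0 with hneg | hnonneg
  · rw [regularPartitionCount, if_neg hneg.not_ge]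
  lift m to ℕ using hnonneg
  have : Fact (Nat.Prime 11) := ⟨by norm_num⟩
  rw [← ZMod.natCast_eq_natCast_iff, natCast_regularPartitionCount,
    coeff_pentagonalSeries_pow_ten_eq_zero, Int.cast_zero, Nat.cast_zero]
  -- `2 * s = x ^ 2 + y ^ 2` gives `s = ((x + y) / 2) ^ 2 + ((x - y) / 2) ^ 2`
  intro x y hxy
  have hparity : Even (x ^ 2 + y ^ 2) := ⟨12 * m + 5, by omega⟩
  obtain ⟨d, rfl⟩ : ∃ d, x = y + 2 * d := by
    rw [Int.even_add, Int.even_pow' two_ne_zero, Int.even_pow' two_ne_zero] at hparity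
    exact ⟨(x - y) / 2, by grind⟩
  exact hm (y + d) d (by linarith)

end RegularPartitions

section Arithmetic

theorem sq_mul_prime_mul_ne_sq_add_sq {p : ℕ} (hp : p.Prime) (hp3 : p ≡ 3 [MOD 4]) {a u : ℤ}
    (ha : a ≠ 0) (hu : ¬ (p : ℤ) ∣ u) (x y : ℤ) : a ^ 2 * p * u ≠ x ^ 2 + y ^ 2 := by
  intro h
  have : Fact p.Prime := ⟨hp⟩
  have ha' : a.natAbs ^ 2 ≠ 0 := pow_ne_zero 2 (Int.natAbs_ne_zero.mpr ha)
  have hu' : ¬ p ∣ u.natAbs := by rwa [← Int.natCast_dvd]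
  have hu0 : u.natAbs ≠ 0 := fun h => hu' (h ▸ dvd_zero p)
  have hap : a.natAbs ^ 2 * p ≠ 0 := mul_ne_zero ha' hp.ne_zero
  have hnat : a.natAbs ^ 2 * p * u.natAbs = x.natAbs ^ 2 + y.natAbs ^ 2 := by
    have := congrArg Int.natAbs h
    rw [Int.natAbs_add_of_nonneg (sq_nonneg x) (sq_nonneg y)] at this
    simpa [Int.natAbs_mul, Int.natAbs_pow] using this
  have heven := Nat.eq_sq_add_sq_iff.mp ⟨_, _, hnat⟩ p
    (Nat.mem_primeFactors.mpr ⟨hp, (dvd_mul_left p _).mul_right _, mul_ne_zero hap hu0⟩) hp3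
  rw [padicValNat.mul hap hu0, padicValNat.mul ha' hp.ne_zero, padicValNat.pow, padicValNat_self,
    padicValNat.eq_zero_of_not_dvd hu'] at heven
  grind

theorem sq_modEq_one_of_isCoprime_six {a : ℤ} (ha : IsCoprime a 6) : a ^ 2 ≡ 1 [ZMOD 12] := by
  obtain ⟨b, c, hbc⟩ := ha
  have h2 : a % 2 ≠ 0 := fun h => by
    have : 2 ∣ b * a := (Int.dvd_of_emod_eq_zero h).mul_left b
    omega
  have h3 : a % 3 ≠ 0 := fun h => by
    have : 3 ∣ b * a := (Int.dvd_of_emod_eq_zero h).mul_left b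
    omega
  have h : a % 12 = 1 ∨ a % 12 = 5 ∨ a % 12 = 7 ∨ a % 12 = 11 := by omega
  rw [Int.ModEq, sq, Int.mul_emod]
  rcases h with h | h | h | h <;> rw [h] <;> rfl

theorem isCoprime_six_of_five_le {p : ℕ} (hp : p.Prime) (h5 : 5 ≤ p) : IsCoprime (p : ℤ) 6 := by
  refine Nat.isCoprime_iff_coprime.mpr (hp.coprime_iff_not_dvd.mpr fun h => ?_)
  have := Nat.le_of_dvd (by norm_num) h
  interval_cases p <;> revert h hp <;> decide

end Arithmetic

theorem theorem1p2_general {a n j : ℤ} {p : ℕ} (ha : IsCoprime a 6) (hp : p.Prime) (hp5 : 5 ≤ p)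
    (hp3 : p ≡ 3 [MOD 4]) (hj : ¬ j ≡ 0 [ZMOD p]) :
    12 ∣ a ^ 2 * p * (12 * j + 5 * p) - 5 ∧
    regularPartitionCount 11
      (a ^ 2 * p ^ 2 * n + (a ^ 2 * p * (12 * j + 5 * p) - 5) / 12) ≡ 0 [MOD 11] := by
  have hcoprime := isCoprime_six_of_five_le hp hp5
  have hsq : 12 ∣ a ^ 2 * p ^ 2 - 1 :=
    ((sq_modEq_one_of_isCoprime_six ha).mul (sq_modEq_one_of_isCoprime_six hcoprime)).symm.dvd
  have hdvd : 12 ∣ a ^ 2 * p * (12 * j + 5 * p) - 5 := by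
    rw [show a ^ 2 * p * (12 * j + 5 * p) - 5 =
      12 * (a ^ 2 * p * j) + 5 * (a ^ 2 * p ^ 2 - 1) by ring]
    exact (dvd_mul_right _ _).add (hsq.mul_left 5)
  refine ⟨hdvd, regularPartitionCount_eleven_modEq_zero fun x y => ?_⟩
  obtain ⟨c, hc⟩ := hdvd
  rw [hc, Int.mul_ediv_cancel_left _ (by norm_num)]
  have hfactor : 12 * (a ^ 2 * p ^ 2 * n + c) + 5 =
      a ^ 2 * p * (12 * (p * n + j) + 5 * p) := by linear_combination -hc
  rw [hfactor]
  refine sq_mul_prime_mul_ne_sq_add_sq hp hp3 ?_ (fun h => hj ?_) x y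
  · rintro rfl
    exact absurd ha (by decide)
  · have hdvd : (p : ℤ) ∣ 6 * (6 * j) := by
      rw [show 6 * (6 * j) = 3 * (12 * (p * n + j) + 5 * p - p * (12 * n + 5)) by ring]
      exact (h.sub (dvd_mul_right _ _)).mul_left 3
    exact Int.modEq_zero_iff_dvd.mpr
      (hcoprime.dvd_of_dvd_mul_left (hcoprime.dvd_of_dvd_mul_left hdvd))

theorem theorem1p2 (α n : ℕ) (p : Fin (α + 1) → ℕ)
    (hprime : ∀ i, (p i).Prime) (hge : ∀ i, 5 ≤ p i) (hmod : ∀ i, p i ≡ 3 [MOD 4])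
    (j : ℤ) (hj : ¬ j ≡ 0 [ZMOD (p (Fin.last α) : ℤ)]) :
    (12 : ℤ) ∣ (∏ i : Fin α, (p i.castSucc : ℤ) ^ 2) * (p (Fin.last α) : ℤ) *
        (12 * j + 5 * (p (Fin.last α) : ℤ)) - 5 ∧
    regularPartitionCount 11
      ((∏ i : Fin (α + 1), (p i : ℤ) ^ 2) * (n : ℤ) +
        ((∏ i : Fin α, (p i.castSucc : ℤ) ^ 2) * (p (Fin.last α) : ℤ) *
          (12 * j + 5 * (p (Fin.last α) : ℤ)) - 5) / 12) ≡ 0 [MOD 11] := by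
  rw [Fin.prod_univ_castSucc, prod_pow]
  exact theorem1p2_general
    (IsCoprime.prod_left fun i _ => isCoprime_six_of_five_le (hprime _) (hge _))
    (hprime _) (hge _) (hmod _) hj
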